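/- Let $(M,d)$ be a perfect (i.e. without isolated points) compact metric space, let $X=M^{\mathbb Z}$, and let $T:X\to X$ be the full shift, $(Tx)_i=x_{i-1}$. Let $(a_k)_{k\ge 0}$ be a monotone increasing sequence of real numbers with $a_k>-1$ for all $k$, $\sum_{k\ge 0}\frac1{a_k+1}<\infty$ and $\lim_{k\to\infty}a_k e^{-\alpha k}=0$ for every $\alpha>0$, and endow $X$ with the metric $$r(x,y)=\sum_{n\in\mathbb Z}\min\Big\{\frac1{a_{|n|}+1},\,d(x_n,y_n)\Big\},$$ which induces the product topology. Let $\mathcal M(T)$ be the space of $T$-invariant Borel probability measures on $X$ with the weak topology. For $E\subset X$ let $\dim_H(E)$ be the Hausdorff dimension and $\dim_P(E)=\inf\{\alpha>0: P^\alpha(E)=0\}$ the packing dimension with respect to $r$ (with $\inf\emptyset=\infty$), where $$P^\alpha(E)=\inf\Big\{\sum_{n} P^\alpha_0(E_n): E\subset\bigcup_{n\in\mathbb N} E_n\Big\},\qquad P_0^\alpha(E)=\lim_{\delta\downarrow0}\,\sup\sum_i(2r_i)^\alpha,$$ the supremum being over all countable families of pairwise disjoint closed balls $\bar B(x_i,r_i)$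 with $x_i\in E$ and $0<2r_i\le\delta$. For a Borel probability measure $\mu$ on $X$ put $$\dim_H^+(\mu)=\inf\{\dim_H(E): E\subset X\text{ Borel},\ \mu(X\setminus E)=0\},\qquad \dim_P^-(\mu)=\inf\{\dim_P(E): E\subset X\text{ Borel},\ \mu(E)>0\}.$$ Then the set $$\{\mu\in\mathcal M(T): \mu\text{ is ergodic},\ \dim_H^+(\mu)=0\ \text{and}\ \dim_P^-(\mu)=\infty\}$$ is residual in $\mathcal M(T)$, that is, it contains a countable intersection of dense open subsets of $\mathcal M(T)$. -/

import Mathlib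

open Set Filter Topology MeasureTheory
open scoped ENNReal NNReal

noncomputable section

/-! ### Packing measures, packing dimension, dimensions of measures -/

/-- `P`, viewed as a family of pairs (center, radius), is a `δ`-packing of `E`: a countable family
of pairwise disjoint closed balls with centers in `E` and with `0 < 2 * radius ≤ δ`. -/
structure IsPacking {X : Type*} [PseudoMetricSpace X] (δ : ℝ) (E : Set X)
    (P : Set (X × ℝ)) : Prop where
  countable : P.Countable
  center_mem : ∀ p ∈ P, p.1 ∈ E
  radius_pos : ∀ p ∈ P, 0 < p.2
  radius_le : ∀ p ∈ P, 2 * p.2 ≤ δ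
  disjoint : P.PairwiseDisjoint fun p => Metric.closedBall p.1 p.2

/-- `P^α_δ(E)`: the supremum of `∑ (2 * radius)^α` over all `δ`-packings of `E`. -/
def packingSup {X : Type*} [PseudoMetricSpace X] (α δ : ℝ) (E : Set X) : ℝ≥0∞ :=
  ⨆ (P : Set (X × ℝ)) (_ : IsPacking δ E P), ∑' p : P, ENNReal.ofReal (2 * p.1.2) ^ α

/-- The packing premeasure `P^α_0(E)`, the decreasing limit of `P^α_δ(E)` as `δ ↓ 0`. -/
def packingPremeasure {X : Type*} [PseudoMetricSpace X] (α : ℝ) (E : Set X) : ℝ≥0∞ :=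
  ⨅ (δ : ℝ) (_ : 0 < δ), packingSup α δ E

/-- The `α`-dimensional packing (outer) measure `P^α(E)`. -/
def packingMeasure {X : Type*} [PseudoMetricSpace X] (α : ℝ) (E : Set X) : ℝ≥0∞ :=
  ⨅ (A : ℕ → Set X) (_ : E ⊆ ⋃ n, A n), ∑' n, packingPremeasure α (A n)

/-- The packing dimension `inf {α > 0 | P^α(E) = 0}`, with `inf ∅ = ∞`. -/
def packingDim {X : Type*} [PseudoMetricSpace X] (E : Set X) : ℝ≥0∞ :=
  ⨅ (α : ℝ≥0) (_ : 0 < α) (_ : packingMeasure (α : ℝ) E = 0), (α : ℝ≥0∞)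

/-- The upper Hausdorff dimension of a measure. -/
def upperHausdorffDim {X : Type*} [MetricSpace X] [MeasurableSpace X] (μ : Measure X) : ℝ≥0∞ :=
  ⨅ (E : Set X) (_ : MeasurableSet E) (_ : μ Eᶜ = 0), dimH E

/-- The lower packing dimension of a measure. -/
def lowerPackingDim {X : Type*} [MetricSpace X] [MeasurableSpace X] (μ : Measure X) : ℝ≥0∞ :=
  ⨅ (E : Set X) (_ : MeasurableSet E) (_ : 0 < μ E), packingDim E

/-! ### The full shift with a sub-exponential metric -/

/-- A monotone sequence `a` with `∑ 1 / (a k + 1) < ∞` and `a k / e ^ (α k) → 0` for all `α > 0`;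
all `a k + 1` are positive. -/
structure SubexpSeq where
  a : ℕ → ℝ
  neg_one_lt : ∀ k, -1 < a k
  monotone : Monotone a
  summable : Summable fun k => 1 / (a k + 1)
  subexp : ∀ α : ℝ, 0 < α → Tendsto (fun k : ℕ => a k / Real.exp (α * k)) atTop (𝓝 0)

/-- The space `M^ℤ`, to be endowed with the metric `r` defined by `w`. -/
def FullShift (M : Type*) (_w : SubexpSeq) : Type _ := ℤ → M

namespace FullShift

variable {M : Type*} {w : SubexpSeq}

/-- `r(x, y) = ∑_{n ∈ ℤ} min {1 / (a_{|n|} + 1), d(x_n, y_n)}`. -/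
def r [MetricSpace M] (x y : FullShift M w) : ℝ :=
  ∑' n : ℤ, min (1 / (w.a n.natAbs + 1)) (dist (x n) (y n))

/-- The product topology. -/
instance [MetricSpace M] : TopologicalSpace (FullShift M w) :=
  inferInstanceAs (TopologicalSpace (ℤ → M))

theorem weight_pos (w : SubexpSeq) (k : ℕ) : 0 < 1 / (w.a k + 1) :=
  one_div_pos.2 (by linarith [w.neg_one_lt k])

theorem summable_weight (w : SubexpSeq) :
    Summable fun n : ℤ => 1 / (w.a n.natAbs + 1) :=
  Summable.of_nat_of_neg (by simpa using w.summable) (by simpa using w.summable)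

theorem term_nonneg [MetricSpace M] (x y : FullShift M w) (n : ℤ) :
    0 ≤ min (1 / (w.a n.natAbs + 1)) (dist (x n) (y n)) :=
  le_min (weight_pos w _).le dist_nonneg

theorem summable_term [MetricSpace M] (x y : FullShift M w) :
    Summable fun n : ℤ => min (1 / (w.a n.natAbs + 1)) (dist (x n) (y n)) :=
  Summable.of_nonneg_of_le (term_nonneg x y) (fun _ => min_le_left _ _) (summable_weight w)

theorem term_le_r [MetricSpace M] (x y : FullShift M w) (n : ℤ) :
    min (1 / (w.a n.natAbs + 1)) (dist (x n) (y n)) ≤ r x y :=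
  (summable_term x y).le_tsum n fun i _ => term_nonneg x y i

/-- The metric space structure given by `r`, with the topology that `r` induces. -/
abbrev metricOfR (M : Type*) (w : SubexpSeq) [MetricSpace M] : MetricSpace (FullShift M w) where
  dist := r
  dist_self x := by
    have h : ∀ n : ℤ, min (1 / (w.a n.natAbs + 1)) (dist (x n) (x n)) = 0 := fun n => by
      rw [dist_self]
      exact min_eq_right (weight_pos w _).le
    simp only [r, h, tsum_zero]
  dist_comm x y := by simp only [r, dist_comm]
  dist_triangle x y z := by
    unfold r
    rw [← (summable_term x y).tsum_add (summable_term y z)]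
    refine (summable_term x z).tsum_le_tsum (fun n => ?_)
      ((summable_term x y).add (summable_term y z))
    have h1 := dist_triangle (x n) (y n) (z n)
    have h2 := weight_pos w n.natAbs
    have h3 : 0 ≤ dist (x n) (y n) := dist_nonneg
    have h4 : 0 ≤ dist (y n) (z n) := dist_nonneg
    rcases min_cases (1 / (w.a n.natAbs + 1)) (dist (x n) (y n)) with h | h <;>
    rcases min_cases (1 / (w.a n.natAbs + 1)) (dist (y n) (z n)) with h' | h' <;>
    rcases min_cases (1 / (w.a n.natAbs + 1)) (dist (x n) (z n)) with h'' | h'' <;>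
    linarith
  eq_of_dist_eq_zero := by
    intro x y h
    funext n
    have h1 : min (1 / (w.a n.natAbs + 1)) (dist (x n) (y n)) ≤ 0 :=
      (term_le_r x y n).trans h.le
    rcases min_le_iff.1 h1 with h2 | h2
    · exact absurd h2 (not_le.2 (weight_pos w _))
    · exact dist_le_zero.1 h2

theorem continuous_r_left [MetricSpace M] (x : FullShift M w) :
    Continuous fun y : FullShift M w => r y x := by
  unfold r
  refine continuous_tsum (fun n => ?_) (summable_weight w) (fun n y => ?_)
  · exact continuous_const.min ((continuous_apply n).dist continuous_const)
  · rw [Real.norm_of_nonneg (term_nonneg y x n)]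
    exact min_le_left _ _

/-- The metric `r` induces the product topology. -/
theorem topology_eq (M : Type*) (w : SubexpSeq) [MetricSpace M] :
    (inferInstance : TopologicalSpace (FullShift M w)) =
      (metricOfR M w).toPseudoMetricSpace.toUniformSpace.toTopologicalSpace := by
  apply le_antisymm
  · intro s hs
    have hs' := (@Metric.isOpen_iff _ (metricOfR M w).toPseudoMetricSpace s).1 hs
    refine isOpen_iff_mem_nhds.2 fun x hx => ?_
    obtain ⟨ε, hε, hsub⟩ := hs' x hx
    have h0 : r x x < ε := by
      have : r x x = 0 := (metricOfR M w).dist_self x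
      linarith
    exact mem_of_superset ((continuous_r_left x).continuousAt.preimage_mem_nhds (Iio_mem_nhds h0))
      hsub
  · refine le_iInf fun n => ?_
    refine continuous_iff_le_induced.1 ?_
    refine (@Metric.continuous_iff _ _ (metricOfR M w).toPseudoMetricSpace _ _).2
      fun x ε hε => ⟨min (1 / (w.a n.natAbs + 1)) ε, lt_min (weight_pos w _) hε, fun y hy => ?_⟩
    have h1 : min (1 / (w.a n.natAbs + 1)) (dist (y n) (x n)) < min (1 / (w.a n.natAbs + 1)) ε :=
      (term_le_r y x n).trans_lt hy
    rcases min_lt_iff.1 h1 with h2 | h2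
    · exact absurd (h2.trans_le (min_le_left _ _)) (lt_irrefl _)
    · exact h2.trans_le (min_le_right _ _)

/-- `M^ℤ` as a metric space with the metric `r` (and, definitionally, the product topology). -/
instance [MetricSpace M] : MetricSpace (FullShift M w) :=
  (metricOfR M w).replaceTopology (topology_eq M w)

/-- The Borel `σ`-algebra. -/
instance [MetricSpace M] : MeasurableSpace (FullShift M w) := borel _

instance [MetricSpace M] : BorelSpace (FullShift M w) := ⟨rfl⟩

/-- The full-shift map, `(T x)_i = x_{i-1}`. -/
def shift (x : FullShift M w) : FullShift M w := fun i => x (i - 1)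

end FullShift

/-- The space `𝓜(T)` of `T`-invariant Borel probability measures on the full shift, with the
topology of weak convergence. -/
abbrev InvariantMeasure (M : Type*) [MetricSpace M] (w : SubexpSeq) : Type _ :=
  {μ : ProbabilityMeasure (FullShift M w) //
    MeasurePreserving FullShift.shift (μ : Measure (FullShift M w)) (μ : Measure (FullShift M w))}

end

/-! ### Semicontinuity and density in spaces of probability measures -/

section Weak

variable {X : Type*} [MetricSpace X] [MeasurableSpace X] [BorelSpace X]

/-! Each of the three properties follows from countably many conditions, each involving a single
scale or a single Birkhoff average, so by Baire category it suffices that every one of them is open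
and dense on its own. Openness is portmanteau: masses of closed sets are upper semicontinuous and
integrals of continuous functions are continuous.

Ergodicity follows from Birkhoff averages of small variance, zero Hausdorff dimension from cheap
covers by small balls of almost all the mass. Both conditions hold for every periodic orbit measure,
and these are dense (`FullShift.dense_of_periodicMeasure_mem`): sample points independently from `μ`
and concatenate long words of them into one periodic sequence.

Infinite packing dimension follows, through the Vitali covering lemma, from ball masses of order `ρ
^ k` at some small `ρ` for each `k` (`HasSmallBalls`). For density, replace every coordinate by one
of two nearby but separated points, chosen by independent coin tosses; perfectness of `M` supplies
the two points. A ball of radius below the weight at `L` then determines `L` tosses and has mass at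
most `2 ^ (-L)`. Since `a` is subexponential, such a radius can be as large as `exp (-β L)` for any
`β > 0`, and a small `β` beats every power `k`. -/

theorem isOpen_setOf_measure_closed_lt {F : Set X} (hF : IsClosed F) (c : ℝ≥0∞) :
    IsOpen {μ : ProbabilityMeasure X | (μ : Measure X) F < c} := by
  refine isOpen_iff_mem_nhds.2 fun μ hμ => ?_
  have h := ProbabilityMeasure.limsup_measure_closed_le_of_tendsto
    (tendsto_id : Tendsto (fun ν : ProbabilityMeasure X => ν) (𝓝 μ) (𝓝 μ)) hF
  exact eventually_lt_of_limsup_lt (h.trans_lt hμ)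

/-- Integrals of bounded continuous functions determine the weak topology; a net indexed by (finite
family, precision) therefore converges to `μ`. -/
theorem mem_closure_of_forall_finset_integral {p : ProbabilityMeasure X → Prop}
    {S : Set {μ : ProbabilityMeasure X // p μ}} {μ : {μ : ProbabilityMeasure X // p μ}}
    (h : ∀ (F : Finset (BoundedContinuousFunction X ℝ)) (ε : ℝ), 0 < ε → ∃ ν ∈ S, ∀ f ∈ F,
      |∫ x, f x ∂(ν.1 : Measure X) - ∫ x, f x ∂(μ.1 : Measure X)| < ε) : μ ∈ closure S := by
  classical
  choose ν hνS hν using h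
  have hpos : ∀ n : ℕ, (0 : ℝ) < 1 / ((n : ℝ) + 1) := fun n => by positivity
  let u : Finset (BoundedContinuousFunction X ℝ) × ℕ → {μ : ProbabilityMeasure X // p μ} :=
    fun i => ν i.1 (1 / ((i.2 : ℝ) + 1)) (hpos i.2)
  refine mem_closure_of_tendsto (f := u) (b := atTop) ?_
    (Eventually.of_forall fun i => hνS _ _ (hpos _))
  refine tendsto_subtype_rng.2 (ProbabilityMeasure.tendsto_iff_forall_integral_tendsto.2 fun f => ?_)
  refine Metric.tendsto_atTop.2 fun ε hε => ?_
  obtain ⟨n, hn⟩ := exists_nat_one_div_lt hε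
  refine ⟨({f}, n), fun i hi => ?_⟩
  have h1 := hν i.1 _ (hpos i.2) f (hi.1 (by simp))
  refine lt_of_lt_of_le h1 (le_trans ?_ hn.le)
  have : (n : ℝ) ≤ i.2 := by exact_mod_cast hi.2
  exact one_div_le_one_div_of_le (by positivity) (by linarith)

end Weak

/-! ### A criterion for vanishing upper Hausdorff dimension -/

section Hausdorff

variable {X : Type*} [MetricSpace X] [MeasurableSpace X] [BorelSpace X]

/-- By Borel–Cantelli almost every point lies in all the covers from some index on. The cost
exponent `1 / (m + 1)` eventually drops below any `s > 0`, so these covers show that the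
`s`-dimensional Hausdorff measure vanishes. -/
theorem upperHausdorffDim_eq_zero_of_covers (μ : Measure X)
    (h : ∀ m : ℕ, ∃ (F : Finset X) (ρ : ℝ), 0 < ρ ∧ 2 * ρ ≤ 1 / ((m : ℝ) + 1) ∧
      (F.card : ℝ≥0∞) * ENNReal.ofReal (2 * ρ) ^ (1 / ((m : ℝ) + 1)) ≤ (1 / 2) ^ m ∧
      μ (⋃ x ∈ F, Metric.ball x ρ)ᶜ < (1 / 2) ^ m) : upperHausdorffDim μ = 0 := by
  choose F ρ hρ hρm hcost hμ using h
  let V : ℕ → Set X := fun m => ⋃ x ∈ F m, Metric.ball x (ρ m)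
  have hV : ∀ m, MeasurableSet (V m) := fun m =>
    (isOpen_biUnion fun _ _ => Metric.isOpen_ball).measurableSet
  let E : Set X := ⋃ k : ℕ, ⋂ m : ℕ, V (k + m)
  have hE : MeasurableSet E := .iUnion fun k => .iInter fun m => hV _
  have hgeom : Tendsto (fun m : ℕ => ((1 / 2 : ℝ≥0∞)) ^ m) atTop (𝓝 0) :=
    ENNReal.tendsto_pow_atTop_nhds_zero_of_lt_one (by simp)
  have hnull : μ Eᶜ = 0 := by
    have hlim : μ (limsup (fun m => (V m)ᶜ) atTop) = 0 := by
      refine measure_limsup_atTop_eq_zero (ne_top_of_le_ne_top ?_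
        (ENNReal.tsum_le_tsum fun m => (hμ m).le))
      rw [ENNReal.tsum_geometric]
      simp
    refine measure_mono_null (fun x hx => ?_) hlim
    rw [mem_limsup_iff_frequently_mem, frequently_atTop]
    intro k
    simp only [E, mem_compl_iff, mem_iUnion, mem_iInter, not_exists, not_forall] at hx
    obtain ⟨m, hm⟩ := hx k
    exact ⟨k + m, by simp, hm⟩
  have hdim : dimH E = 0 := by
    rw [dimH_iUnion, ENNReal.iSup_eq_zero]
    intro k
    refine le_antisymm (ENNReal.le_of_forall_pos_le_add fun s hs _ => ?_) bot_le
    rw [zero_add]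
    refine dimH_le_of_hausdorffMeasure_ne_top ?_
    have hdiam : ∀ (m : ℕ) (x : X),
        Metric.ediam (Metric.ball x (ρ m)) ≤ ENNReal.ofReal (2 * ρ m) := by
      intro m x
      rw [← Metric.eball_ofReal]
      refine Metric.ediam_eball_le.trans ?_
      rw [ENNReal.ofReal_mul (by norm_num)]
      simp
    have hrad : ∀ m, ENNReal.ofReal (2 * ρ m) ≤ ENNReal.ofReal (1 / ((m : ℝ) + 1)) :=
      fun m => ENNReal.ofReal_le_ofReal (hρm m)
    have hrad0 : Tendsto (fun m : ℕ => ENNReal.ofReal (1 / ((m : ℝ) + 1))) atTop (𝓝 0) := by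
      simpa using ENNReal.tendsto_ofReal tendsto_one_div_add_atTop_nhds_zero_nat
    have hle := Measure.hausdorffMeasure_le_liminf_tsum (β := ℕ) (ι := fun m => F m) (s : ℝ)
      (⋂ m : ℕ, V (k + m)) (l := atTop) (fun m : ℕ => ENNReal.ofReal (1 / ((m : ℝ) + 1)))
      hrad0 (fun m x => Metric.ball x.1 (ρ m))
      (Eventually.of_forall fun m x => (hdiam m x).trans (hrad m)) (by
        filter_upwards [eventually_ge_atTop k] with m hm x hx
        have := mem_iInter.1 hx (m - k)
        rw [Nat.add_sub_cancel' hm] at this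
        simpa [V] using this)
    have hb : ∀ᶠ m : ℕ in atTop,
        ∑' x : F m, Metric.ediam (Metric.ball x.1 (ρ m)) ^ (s : ℝ) ≤ (1 / 2) ^ m := by
      have h1 : ∀ᶠ m : ℕ in atTop, 1 / ((m : ℝ) + 1) ≤ s :=
        tendsto_one_div_add_atTop_nhds_zero_nat.eventually_le_const (by exact_mod_cast hs)
      filter_upwards [h1] with m hm
      refine le_trans ?_ (hcost m)
      rw [tsum_fintype]
      calc ∑ x : F m, Metric.ediam (Metric.ball x.1 (ρ m)) ^ (s : ℝ)
          ≤ ∑ x : F m, ENNReal.ofReal (2 * ρ m) ^ (1 / ((m : ℝ) + 1)) := by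
            refine Finset.sum_le_sum fun x _ => ?_
            refine (ENNReal.rpow_le_rpow (hdiam m x) s.2).trans ?_
            -- The base is at most 1, so passing to the smaller exponent enlarges the power.
            refine ENNReal.rpow_le_rpow_of_exponent_ge ((hrad m).trans ?_) hm
            rw [ENNReal.ofReal_le_one, div_le_one (by positivity)]
            simp
        _ = _ := by simp
    have : liminf (fun m => ∑' x : F m, Metric.ediam (Metric.ball x.1 (ρ m)) ^ (s : ℝ)) atTop
        ≤ 0 := by
      rw [← hgeom.liminf_eq]
      exact liminf_le_liminf hb
    exact ne_top_of_le_ne_top ENNReal.zero_ne_top (hle.trans this)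
  refine le_antisymm ?_ bot_le
  exact (iInf₂_le E hE).trans ((iInf_le _ hnull).trans hdim.le)

end Hausdorff

/-! ### A criterion for infinite lower packing dimension -/

section Packing

variable {X : Type*} [MetricSpace X] [TopologicalSpace.SeparableSpace X] [MeasurableSpace X]

/-- `μ` satisfies ball bounds of arbitrarily large polynomial order at arbitrarily small scales. -/
def HasSmallBalls (μ : Measure X) : Prop :=
  ∀ k : ℕ, ∃ ρ : ℝ, 0 < ρ ∧ 2 * ρ ≤ 1 / ((k : ℝ) + 1) ∧
    ∀ z, μ (Metric.closedBall z (5 * ρ)) ≤ ENNReal.ofReal (2 * ρ) ^ (k : ℝ)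

/-- A Vitali subfamily of the balls of radius `ρ` is a packing whose fivefold enlargements cover
`E`. Each enlargement has mass at most `(2ρ) ^ k ≤ (2ρ) ^ (α + 1)`, and the spare factor `2ρ` is at
most `1 / (k + 1)`. -/
theorem HasSmallBalls.measure_le_packingSup {μ : Measure X} (h : HasSmallBalls μ) (α : ℝ)
    {δ : ℝ} (E : Set X) {k : ℕ} (hα : α + 1 ≤ k) (hk : 1 / ((k : ℝ) + 1) ≤ δ) :
    μ E ≤ ENNReal.ofReal (1 / ((k : ℝ) + 1)) * packingSup α δ E := by
  obtain ⟨ρ, hρ, hρk, hball⟩ := h k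
  obtain ⟨u, huE, hdisj, hcov⟩ := Vitali.exists_disjoint_subfamily_covering_enlargement_closedBall
    E (fun x => x) (fun _ => ρ) ρ (fun _ _ => le_rfl) 5 (by norm_num)
  have hu : u.Countable := hdisj.countable_of_nonempty_interior fun x _ =>
    ⟨x, Metric.ball_subset_interior_closedBall (Metric.mem_ball_self hρ)⟩
  have hsub : E ⊆ ⋃ x ∈ u, Metric.closedBall x (5 * ρ) := fun x hx => by
    obtain ⟨y, hy, hxy⟩ := hcov x hx
    exact mem_biUnion hy (hxy (Metric.mem_closedBall_self hρ.le))
  have hpos : ENNReal.ofReal (2 * ρ) ≠ 0 := by simpa using hρ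
  have hone : ENNReal.ofReal (2 * ρ) ≤ 1 := by
    rw [ENNReal.ofReal_le_one]
    refine hρk.trans ?_
    rw [div_le_one (by positivity)]
    simp
  let P : Set (X × ℝ) := (fun x => (x, ρ)) '' u
  have hP : IsPacking δ E P := by
    refine ⟨hu.image _, ?_, ?_, ?_, ?_⟩
    · rintro _ ⟨x, hx, rfl⟩; exact huE hx
    · rintro _ ⟨x, hx, rfl⟩; exact hρ
    · rintro _ ⟨x, hx, rfl⟩; exact hρk.trans hk
    · rintro _ ⟨x, hx, rfl⟩ _ ⟨y, hy, rfl⟩ hxy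
      exact hdisj hx hy fun h => hxy (by rw [h])
  have hsum : ∑' p : P, ENNReal.ofReal (2 * p.1.2) ^ α = ∑' _ : u, ENNReal.ofReal (2 * ρ) ^ α := by
    have hinj : Function.Injective fun x : X => (x, ρ) := fun x y h => (Prod.ext_iff.1 h).1
    exact tsum_image (fun p : X × ℝ => ENNReal.ofReal (2 * p.2) ^ α) hinj.injOn
  calc μ E ≤ μ (⋃ x ∈ u, Metric.closedBall x (5 * ρ)) := measure_mono hsub
    _ ≤ ∑' x : u, μ (Metric.closedBall x.1 (5 * ρ)) := measure_biUnion_le μ hu _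
    _ ≤ ∑' _ : u, ENNReal.ofReal (1 / ((k : ℝ) + 1)) * ENNReal.ofReal (2 * ρ) ^ α := by
      refine ENNReal.tsum_le_tsum fun x => (hball x).trans ?_
      refine (ENNReal.rpow_le_rpow_of_exponent_ge hone hα).trans ?_
      rw [ENNReal.rpow_add _ _ hpos ENNReal.ofReal_ne_top, ENNReal.rpow_one, mul_comm]
      gcongr
    _ = ENNReal.ofReal (1 / ((k : ℝ) + 1)) * ∑' p : P, ENNReal.ofReal (2 * p.1.2) ^ α := by
      rw [ENNReal.tsum_mul_left, hsum]
    _ ≤ _ := by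
      gcongr
      exact le_iSup₂ (f := fun (P : Set (X × ℝ)) (_ : IsPacking δ E P) =>
        ∑' p : P, ENNReal.ofReal (2 * p.1.2) ^ α) P hP

theorem HasSmallBalls.packingPremeasure_eq_top {μ : Measure X} (h : HasSmallBalls μ) (α : ℝ)
    {E : Set X} (hE : μ E ≠ 0) : packingPremeasure α E = ⊤ := by
  refine iInf₂_eq_top.2 fun δ hδ => ?_
  by_contra hne
  refine hE (le_antisymm ?_ bot_le)
  have h0 : Tendsto (fun k : ℕ => ENNReal.ofReal (1 / ((k : ℝ) + 1)) * packingSup α δ E) atTop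
      (𝓝 0) := by
    have := ENNReal.Tendsto.mul_const (b := packingSup α δ E)
      (ENNReal.tendsto_ofReal tendsto_one_div_add_atTop_nhds_zero_nat) (Or.inr hne)
    simpa using this
  refine ge_of_tendsto h0 ?_
  filter_upwards [tendsto_natCast_atTop_atTop.eventually_ge_atTop (α + 1),
    tendsto_one_div_add_atTop_nhds_zero_nat.eventually_le_const hδ] with k h1 h2
  exact h.measure_le_packingSup α E h1 h2

theorem HasSmallBalls.lowerPackingDim_eq_top {μ : Measure X} (h : HasSmallBalls μ) :
    lowerPackingDim μ = ⊤ := by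
  refine iInf₂_eq_top.2 fun E _ => iInf_eq_top.2 fun hE => ?_
  refine iInf₂_eq_top.2 fun α _ => iInf_eq_top.2 fun h0 => ?_
  exfalso
  -- Zero packing measure gives a countable cover with premeasures summing to less than 1; a piece
  -- of positive mass would have infinite premeasure.
  have h1 : packingMeasure (α : ℝ) E < 1 := by rw [h0]; exact one_pos
  simp only [packingMeasure, iInf_lt_iff] at h1
  obtain ⟨A, hA, hlt⟩ := h1
  refine hE.ne' (measure_mono_null hA (measure_iUnion_null fun n => ?_))
  by_contra hn
  have := (ENNReal.le_tsum (f := fun n => packingPremeasure (α : ℝ) (A n)) n).trans_lt hlt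
  rw [h.packingPremeasure_eq_top _ hn] at this
  exact not_top_lt this

end Packing

/-! ### A criterion for ergodicity -/

section Ergodicity

theorem continuous_birkhoffAverage {X : Type*} [TopologicalSpace X] {T : X → X}
    (hT : Continuous T) {f : X → ℝ} (hf : Continuous f) (N : ℕ) : Continuous (birkhoffAverage ℝ T f N) := by
  unfold birkhoffAverage birkhoffSum
  exact (continuous_finsetSum _ fun k _ => hf.comp (hT.iterate k)).const_smul (N : ℝ)⁻¹

theorem integral_birkhoffAverage {X : Type*} [MeasurableSpace X] {μ : Measure X} {T : X → X}
    (hT : MeasurePreserving T μ μ) {f : X → ℝ} (hf : Integrable f μ) {N : ℕ} (hN : 0 < N) :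
    ∫ x, birkhoffAverage ℝ T f N x ∂μ = ∫ x, f x ∂μ := by
  have hN' : (N : ℝ) ≠ 0 := by positivity
  have hk : ∀ k, ∫ x, f (T^[k] x) ∂μ = ∫ x, f x ∂μ := fun k => by
    have hmp := hT.iterate k
    rw [← integral_map hmp.measurable.aemeasurable (by rw [hmp.map_eq]; exact hf.1), hmp.map_eq]
  simp only [birkhoffAverage, birkhoffSum, smul_eq_mul]
  have hfk : ∀ k, Integrable (fun x => f (T^[k] x)) μ := fun k =>
    (hT.iterate k).integrable_comp_of_integrable hf
  rw [integral_const_mul, integral_finsetSum _ fun k _ => hfk k]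
  simp only [hk, Finset.sum_const, Finset.card_range, nsmul_eq_mul]
  field_simp

variable {X : Type*} [MetricSpace X] [CompactSpace X] [MeasurableSpace X] [BorelSpace X]

theorem Continuous.integrable_of_compactSpace (μ : Measure X) [IsFiniteMeasure μ]
    {f : X → ℝ} (hf : Continuous f) : Integrable f μ :=
  (BoundedContinuousFunction.mkOfCompact ⟨f, hf⟩).integrable μ

/-- Since `i` is invariant, `i - A_N f` is the average of the functions `(i - f) ∘ T^k`, all of the
same `L¹` norm. -/
theorem integral_abs_sub_birkhoffAverage_le {μ : Measure X} [IsFiniteMeasure μ] {T : X → X}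
    (hTc : Continuous T) (hT : MeasurePreserving T μ μ) {f : X → ℝ} (hf : Continuous f)
    {i : X → ℝ} (hi : Integrable i μ) (hiT : ∀ x, i (T x) = i x) {N : ℕ} (hN : 0 < N) :
    ∫ x, |i x - birkhoffAverage ℝ T f N x| ∂μ ≤ ∫ x, |i x - f x| ∂μ := by
  have hN' : (0 : ℝ) < N := by positivity
  have hfi := Continuous.integrable_of_compactSpace μ hf
  have hintg : Integrable (fun x => |i x - f x|) μ := (hi.sub hfi).abs
  rw [← integral_birkhoffAverage hT hintg hN]
  have hitk : ∀ k x, i (T^[k] x) = i x := by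
    intro k
    induction k with
    | zero => simp
    | succ k ih => intro x; rw [Function.iterate_succ_apply, ih, hiT]
  have hfk : ∀ k, Integrable (fun x => |i (T^[k] x) - f (T^[k] x)|) μ := fun k =>
    (hT.iterate k).integrable_comp_of_integrable hintg
  refine integral_mono ?_ ?_ fun x => ?_
  · exact (hi.sub (Continuous.integrable_of_compactSpace μ
      (continuous_birkhoffAverage hTc hf N))).abs
  · exact (integrable_finsetSum _ fun k _ => hfk k).smul (N : ℝ)⁻¹
  · simp only [birkhoffAverage, birkhoffSum, smul_eq_mul, hitk]
    have h1 : i x - (N : ℝ)⁻¹ * ∑ k ∈ Finset.range N, f (T^[k] x) =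
        (N : ℝ)⁻¹ * ∑ k ∈ Finset.range N, (i x - f (T^[k] x)) := by
      rw [Finset.sum_sub_distrib]
      simp only [Finset.sum_const, Finset.card_range, nsmul_eq_mul]
      field_simp
    rw [h1, abs_mul, abs_of_pos (inv_pos.2 hN')]
    gcongr
    exact Finset.abs_sum_le_sum_abs _ _

/-- Integrate `|u| ≤ u² / (2ε) + ε / 2` with `u = g - c`. -/
theorem integral_abs_sub_const_le {μ : Measure X} [IsProbabilityMeasure μ] {g : X → ℝ}
    (hg : Continuous g) {ε : ℝ} (hε : 0 < ε)
    (hvar : ∫ x, g x ^ 2 ∂μ - (∫ x, g x ∂μ) ^ 2 < ε ^ 2) :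
    ∫ x, |g x - ∫ y, g y ∂μ| ∂μ ≤ ε := by
  set c := ∫ y, g y ∂μ with hc
  have hI : ∀ {u : X → ℝ}, Continuous u → Integrable u μ := fun hu =>
    Continuous.integrable_of_compactSpace μ hu
  have hle : ∫ x, |g x - c| ∂μ ≤ ∫ x, ((2 * ε)⁻¹ * g x ^ 2 - ε⁻¹ * c * g x +
      ((2 * ε)⁻¹ * c ^ 2 + ε / 2)) ∂μ := by
    refine integral_mono (hI (by fun_prop)) (hI (by fun_prop)) fun x => ?_
    have h2 : (2 * ε)⁻¹ * g x ^ 2 - ε⁻¹ * c * g x + ((2 * ε)⁻¹ * c ^ 2 + ε / 2) - |g x - c| =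
        (2 * ε)⁻¹ * (|g x - c| - ε) ^ 2 := by
      field_simp
      linear_combination (-1) * (sq_abs (g x - c))
    have h3 : 0 ≤ (2 * ε)⁻¹ * (|g x - c| - ε) ^ 2 := by positivity
    dsimp only
    linarith
  rw [integral_add (hI (by fun_prop)) (integrable_const _),
    integral_sub (hI (by fun_prop)) (hI (by fun_prop)), integral_const_mul, integral_const_mul,
    ← hc] at hle
  simp only [integral_const, probReal_univ, one_smul] at hle
  refine hle.trans ?_
  have h4 : (2 * ε)⁻¹ * (∫ x, g x ^ 2 ∂μ - c ^ 2) ≤ (2 * ε)⁻¹ * ε ^ 2 := by gcongr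
  have h5 : (2 * ε)⁻¹ * ε ^ 2 = ε / 2 := by field_simp
  have h6 : ε⁻¹ * c * c = 2 * ((2 * ε)⁻¹ * c ^ 2) := by field_simp
  linarith

/-- The indicator of an invariant set is `L¹`-close to some `f ∈ D`, hence to all Birkhoff averages
of `f`, one of which is close to a constant. An indicator close to a constant has mean near 0 or 1.
-/
theorem ergodic_of_birkhoffAverage_variance {μ : Measure X} [IsProbabilityMeasure μ] {T : X → X}
    (hTc : Continuous T) (hT : MeasurePreserving T μ μ) {D : Set C(X, ℝ)} (hD : Dense D)
    (h : ∀ f ∈ D, ∀ ε : ℝ, 0 < ε → ∃ N : ℕ, 0 < N ∧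
      ∫ x, birkhoffAverage ℝ T f N x ^ 2 ∂μ - (∫ x, f x ∂μ) ^ 2 < ε) : Ergodic T μ := by
  refine ⟨hT, ⟨fun s hs hTs => ?_⟩⟩
  set p := μ.real s with hp
  have hp0 : 0 ≤ p := measureReal_nonneg
  have hp1 : p ≤ 1 := measureReal_le_one
  let i : X → ℝ := s.indicator fun _ => 1
  have hi : Integrable i μ := (integrable_const _).indicator hs
  have hip : ∫ x, i x ∂μ = p := by simp [i, integral_indicator hs, hp]
  have hiT : ∀ x, i (T x) = i x := fun x => by
    have : T x ∈ s ↔ x ∈ s := by rw [← mem_preimage, hTs]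
    by_cases hx : x ∈ s <;> simp [i, hx, this]
  have key : ∀ ε : ℝ, 0 < ε → min p (1 - p) ≤ 3 * ε := by
    intro ε hε
    obtain ⟨f₀, hf₀, hf₀i⟩ := hi.exists_boundedContinuous_integral_sub_le hε
    obtain ⟨f, hfD, hf⟩ := hD.exists_dist_lt f₀.toContinuousMap hε
    have hfi := Continuous.integrable_of_compactSpace μ f.continuous
    have hif : ∫ x, |i x - f x| ∂μ ≤ 2 * ε := by
      have : ∫ x, |i x - f x| ∂μ ≤ ∫ x, (‖i x - f₀ x‖ + ε) ∂μ := by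
        refine integral_mono (hi.sub hfi).abs ((hi.sub hf₀i).norm.add (integrable_const _))
          fun x => ?_
        have h1 : |f₀ x - f x| ≤ ε := ((ContinuousMap.dist_apply_le_dist x).trans hf.le)
        have h2 := abs_add_le (i x - f₀ x) (f₀ x - f x)
        rw [sub_add_sub_cancel] at h2
        dsimp only
        rw [Real.norm_eq_abs]
        linarith
      have hn : Integrable (fun x => ‖i x - f₀ x‖) μ := (hi.sub hf₀i).norm
      rw [integral_add hn (integrable_const _)] at this
      simp only [integral_const, probReal_univ, one_smul] at this
      linarith
    obtain ⟨N, hN, hvar⟩ := h f hfD (ε ^ 2) (by positivity)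
    have hgc := continuous_birkhoffAverage hTc f.continuous N
    have hg := Continuous.integrable_of_compactSpace μ hgc
    have hgf := integral_birkhoffAverage hT hfi hN
    have h1 := integral_abs_sub_birkhoffAverage_le hTc hT f.continuous hi hiT hN
    have h2 := integral_abs_sub_const_le hgc hε (by rw [hgf]; exact hvar)
    set c := ∫ x, birkhoffAverage ℝ T f N x ∂μ
    have h3 : ∫ x, |i x - c| ∂μ ≤ ∫ x, (|i x - birkhoffAverage ℝ T f N x| +
        |birkhoffAverage ℝ T f N x - c|) ∂μ := by
      refine integral_mono (hi.sub (integrable_const _)).abs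
        ((hi.sub hg).abs.add (hg.sub (integrable_const _)).abs) fun x => ?_
      have := abs_add_le (i x - birkhoffAverage ℝ T f N x) (birkhoffAverage ℝ T f N x - c)
      rwa [sub_add_sub_cancel] at this
    have ha : Integrable (fun x => |i x - birkhoffAverage ℝ T f N x|) μ := (hi.sub hg).abs
    have hb : Integrable (fun x => |birkhoffAverage ℝ T f N x - c|) μ :=
      (hg.sub (integrable_const c)).abs
    rw [integral_add ha hb] at h3
    have h4 : ∫ x, |i x - c| ∂μ = p * |1 - c| + (1 - p) * |c| := by
      have : ∀ x, |i x - c| = i x * (|1 - c| - |c|) + |c| := fun x => by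
        by_cases hx : x ∈ s <;> simp [i, hx]
      simp only [this]
      rw [integral_add (hi.mul_const _) (integrable_const _), integral_mul_const, hip]
      simp only [integral_const, probReal_univ, one_smul]
      ring
    have h5 : min p (1 - p) ≤ p * |1 - c| + (1 - p) * |c| := by
      have h6 : 1 ≤ |1 - c| + |c| := by
        have := abs_add_le (1 - c) c
        simpa using this
      have h7 : 0 ≤ min p (1 - p) := le_min hp0 (by linarith)
      calc min p (1 - p) ≤ min p (1 - p) * (|1 - c| + |c|) := le_mul_of_one_le_right h7 h6
        _ = min p (1 - p) * |1 - c| + min p (1 - p) * |c| := by ring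
        _ ≤ _ := by
          gcongr
          · exact min_le_left _ _
          · exact min_le_right _ _
    linarith
  have hmin : min p (1 - p) ≤ 0 := by
    refine le_of_forall_pos_le_add fun ε hε => ?_
    have := key (ε / 3) (by positivity)
    linarith
  rw [eventuallyConst_set']
  rcases min_le_iff.1 hmin with h0 | h0
  · left
    have : p = 0 := le_antisymm h0 hp0
    rw [ae_eq_empty]
    exact (measureReal_eq_zero_iff).1 this
  · right
    have : p = 1 := by linarith
    rw [ae_eq_univ, prob_compl_eq_zero_iff hs]
    rw [← ENNReal.toReal_eq_one_iff]
    exact this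

end Ergodicity

/-! ### Periodic orbit measures -/

section PeriodicOrbit

variable {X : Type*} [MeasurableSpace X]

/-- The uniform probability measure on the first `p` points of the orbit of `x`. -/
noncomputable def orbitMeasure (T : X → X) (x : X) (p : ℕ) : Measure X :=
  (p : ℝ≥0∞)⁻¹ • ∑ k ∈ Finset.range p, Measure.dirac (T^[k] x)

theorem isProbabilityMeasure_orbitMeasure (T : X → X) (x : X) {p : ℕ} (hp : 0 < p) :
    IsProbabilityMeasure (orbitMeasure T x p) := by
  refine ⟨?_⟩
  simp only [orbitMeasure, Measure.smul_apply, Measure.finsetSum_apply, measure_univ,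
    Finset.sum_const, Finset.card_range, nsmul_eq_mul, mul_one, smul_eq_mul]
  exact ENNReal.inv_mul_cancel (by simpa using hp.ne') (ENNReal.natCast_ne_top p)

theorem measurePreserving_orbitMeasure {T : X → X} (hT : Measurable T) {x : X} {p : ℕ}
    (hx : T^[p] x = x) : MeasurePreserving T (orbitMeasure T x p) (orbitMeasure T x p) := by
  refine ⟨hT, ?_⟩
  have h1 : (∑ k ∈ Finset.range p, Measure.dirac (T^[k] x)).map T =
      ∑ k ∈ Finset.range p, Measure.dirac (T^[k + 1] x) := by
    rw [← Measure.mapₗ_apply_of_measurable hT, map_sum]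
    refine Finset.sum_congr rfl fun k _ => ?_
    rw [Measure.mapₗ_apply_of_measurable hT, Measure.map_dirac' hT, Function.iterate_succ_apply']
  rw [orbitMeasure, Measure.map_smul, h1]
  congr 1
  rcases p with _ | p
  · simp
  · rw [Finset.sum_range_succ, hx, Finset.sum_range_succ']
    simp

theorem integral_orbitMeasure {T : X → X} {f : X → ℝ} (hf : StronglyMeasurable f) (x : X) (p : ℕ) :
    ∫ y, f y ∂(orbitMeasure T x p) = birkhoffAverage ℝ T f p x := by
  have hi : ∀ y, Integrable f (Measure.dirac y) := fun y => integrable_dirac' hf (by simp)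
  rw [orbitMeasure, integral_smul_measure, integral_finsetSum_measure fun k _ => hi _]
  simp [integral_dirac' _ _ hf, birkhoffAverage, birkhoffSum]

theorem orbitMeasure_compl_eq_zero {T : X → X} {x : X} {p : ℕ} {s : Set X} (hs : MeasurableSet s)
    (h : ∀ k < p, T^[k] x ∈ s) : orbitMeasure T x p sᶜ = 0 := by
  simp only [orbitMeasure, Measure.smul_apply, Measure.finsetSum_apply, smul_eq_mul]
  rw [Finset.sum_eq_zero, mul_zero]
  intro k hk
  rw [Measure.dirac_apply' _ hs.compl]
  simpa using h k (Finset.mem_range.1 hk)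

theorem birkhoffAverage_iterate_eq {X : Type*} {T : X → X} {x : X} {p : ℕ} (hx : T^[p] x = x)
    (f : X → ℝ) (k : ℕ) : birkhoffAverage ℝ T f p (T^[k] x) = birkhoffAverage ℝ T f p x := by
  have h1 : ∀ y, T^[p] y = y → birkhoffAverage ℝ T f p (T y) = birkhoffAverage ℝ T f p y := by
    intro y hy
    have := birkhoffAverage_apply_sub_birkhoffAverage (R := ℝ) T f p y
    rw [hy, sub_self, smul_zero] at this
    linarith
  induction k with
  | zero => rfl
  | succ k ih =>
    rw [Function.iterate_succ_apply', h1, ih]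
    rw [← Function.iterate_add_apply, add_comm, Function.iterate_add_apply, hx]

/-- The average over a full period is constant along the orbit. -/
theorem orbitMeasure_variance_eq_zero {T : X → X} (hT : Measurable T) {x : X} {p : ℕ}
    (hp : 0 < p) (hx : T^[p] x = x) {f : X → ℝ} (hf : Measurable f) :
    ∫ y, birkhoffAverage ℝ T f p y ^ 2 ∂(orbitMeasure T x p) -
      (∫ y, f y ∂(orbitMeasure T x p)) ^ 2 = 0 := by
  have hm : Measurable (birkhoffAverage ℝ T f p) := by
    unfold birkhoffAverage birkhoffSum
    exact (Finset.measurable_fun_sum _ fun k _ => hf.comp (hT.iterate k)).const_smul (p : ℝ)⁻¹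
  have hp' : (p : ℝ) ≠ 0 := by positivity
  rw [integral_orbitMeasure (hm.pow_const 2).stronglyMeasurable,
    integral_orbitMeasure hf.stronglyMeasurable]
  conv_lhs => enter [1]; rw [birkhoffAverage, birkhoffSum]
  simp only [birkhoffAverage_iterate_eq hx, Finset.sum_const, Finset.card_range]
  simp [hp']

end PeriodicOrbit

/-! ### Sampling -/

/-- Strong law of large numbers for independent samples of `μ`, applied to finitely many functions
at once. -/
theorem exists_sample_averages_close {X : Type*} [MeasurableSpace X] (μ : Measure X)
    [IsProbabilityMeasure μ] (F : Finset (X → ℝ)) (hFm : ∀ f ∈ F, Measurable f)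
    (hF : ∀ f ∈ F, Integrable f μ) {ε : ℝ} (hε : 0 < ε) :
    ∃ (m : ℕ) (x : ℕ → X), 0 < m ∧ ∀ f ∈ F,
      |(∑ j ∈ Finset.range m, f (x j)) / m - ∫ y, f y ∂μ| < ε := by
  let P := Measure.infinitePi fun _ : ℕ => μ
  have hlaw : ∀ f ∈ F, ∀ᵐ x ∂P, Tendsto (fun m : ℕ => (∑ j ∈ Finset.range m, f (x j)) / m) atTop
      (𝓝 (∫ y, f y ∂μ)) := by
    intro f hf
    have hmp : ∀ j, MeasurePreserving (Function.eval j) P μ := fun j =>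
      measurePreserving_eval_infinitePi (fun _ : ℕ => μ) j
    have hind := ProbabilityTheory.iIndepFun_infinitePi (P := fun _ : ℕ => μ)
      (X := fun _ => f) (fun _ => hFm f hf)
    have hintg : ∫ x, f (x 0) ∂P = ∫ y, f y ∂μ := by
      have hm := (hmp 0).map_eq
      calc ∫ x, f (x 0) ∂P = ∫ y, f y ∂(P.map (Function.eval 0)) :=
            (integral_map (hmp 0).measurable.aemeasurable (by rw [hm]; exact (hF f hf).1)).symm
        _ = _ := by rw [hm]
    have hsl := ProbabilityTheory.strong_law_ae_real (μ := P) (fun j (x : ℕ → X) => f (x j))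
      ((hmp 0).integrable_comp_of_integrable (hF f hf))
      (fun i j hij => hind.indepFun hij) (fun j => ?_)
    · rw [hintg] at hsl
      exact hsl
    · refine ⟨((hFm f hf).comp (hmp j).measurable).aemeasurable,
        ((hFm f hf).comp (hmp 0).measurable).aemeasurable, ?_⟩
      have h1 : ∀ j, P.map (fun x => f (x j)) = μ.map f := fun j => by
        rw [← (hmp j).map_eq, Measure.map_map (hFm f hf) (hmp j).measurable]
        rfl
      rw [h1, h1]
  have hall : ∀ᵐ x ∂P, ∀ f ∈ F, Tendsto (fun m : ℕ => (∑ j ∈ Finset.range m, f (x j)) / m) atTop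
      (𝓝 (∫ y, f y ∂μ)) := (ae_ball_iff F.countable_toSet).2 fun f hf => hlaw f hf
  obtain ⟨x, hx⟩ := hall.exists
  have hev : ∀ᶠ m : ℕ in atTop, ∀ f ∈ F,
      |(∑ j ∈ Finset.range m, f (x j)) / m - ∫ y, f y ∂μ| < ε :=
    (eventually_all_finset F).2 fun f hf => Metric.tendsto_nhds.1 (hx f hf) ε hε
  obtain ⟨m, hm, hm0⟩ := (hev.and (eventually_gt_atTop 0)).exists
  exact ⟨m, x, hm0, hm⟩

/-! ### Density of periodic orbit measures -/

namespace FullShift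

variable {M : Type*} {w : SubexpSeq}

theorem iterate_shift_apply (x : FullShift M w) (k : ℕ) (i : ℤ) :
    (shift^[k] x) i = x (i - k) := by
  induction k generalizing x i with
  | zero => simp
  | succ k ih =>
    rw [Function.iterate_succ_apply', shift, ih]
    congr 1
    push_cast
    ring

/-- The periodic sequence obtained by concatenating the words `x q (-(n-1)), …, x q 0`, where `q`
ranges over the residues modulo `m`. -/
def concat (n m : ℕ) (x : ℕ → FullShift M w) : FullShift M w :=
  fun i => x ((-i / (n : ℤ)) % (m : ℤ)).toNat (-(-i % (n : ℤ)))

theorem iterate_shift_concat {n : ℕ} (hn : 0 < n) (m : ℕ) (x : ℕ → FullShift M w) :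
    shift^[m * n] (concat n m x) = concat n m x := by
  funext i
  rw [iterate_shift_apply]
  have hn' : (n : ℤ) ≠ 0 := by exact_mod_cast hn.ne'
  have h : -(i - ((m * n : ℕ) : ℤ)) = -i + m * n := by push_cast; ring
  simp only [concat, h]
  rw [Int.add_mul_ediv_right _ _ hn', Int.add_mul_emod_self_right, Int.add_emod_right]

/-- Forward iterates of the shift read coordinates to the left, so words sit on nonpositive
coordinates. At times at least `L` away from the block ends, the window of radius `L` stays inside
one word. -/
theorem iterate_shift_concat_apply {n m : ℕ} (x : ℕ → FullShift M w) {q s L : ℕ} (hq : q < m)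
    (hs : L ≤ s) (hsn : s + L < n) {i : ℤ} (hi : i.natAbs ≤ L) :
    (shift^[s] (shift^[q * n] (concat n m x))) i = (shift^[s] (x q)) i := by
  rw [iterate_shift_apply, iterate_shift_apply, iterate_shift_apply]
  have h : -(i - (s : ℤ) - ((q * n : ℕ) : ℤ)) = (s - i) + q * n := by push_cast; ring
  have h0 : (0 : ℤ) ≤ s - i := by omega
  have h1 : (s - i : ℤ) < n := by omega
  have hn' : (n : ℤ) ≠ 0 := by omega
  simp only [concat, h]
  rw [Int.add_mul_ediv_right _ _ hn', Int.add_mul_emod_self_right, Int.ediv_eq_zero_of_lt h0 h1,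
    Int.emod_eq_of_lt h0 h1, zero_add, Int.emod_eq_of_lt (by omega) (by omega), Int.toNat_natCast,
    neg_sub]

variable [MetricSpace M]

theorem dist_eq_r (x y : FullShift M w) : dist x y = r x y := rfl

instance [CompactSpace M] : CompactSpace (FullShift M w) :=
  inferInstanceAs (CompactSpace (ℤ → M))

theorem continuous_shift : Continuous (shift : FullShift M w → FullShift M w) :=
  continuous_pi fun i => continuous_apply (i - 1)

/-- Only the tail of the summable weights contributes. -/
theorem exists_dist_lt_of_eqOn (w : SubexpSeq) {δ : ℝ} (hδ : 0 < δ) :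
    ∃ L : ℕ, ∀ x y : FullShift M w, (∀ i : ℤ, i.natAbs ≤ L → x i = y i) → dist x y < δ := by
  have h := tendsto_tsum_compl_atTop_zero fun n : ℤ => 1 / (w.a n.natAbs + 1)
  obtain ⟨S, hS⟩ := (h.eventually_lt_const hδ).exists
  refine ⟨S.sup Int.natAbs, fun x y hxy => lt_of_le_of_lt ?_ hS⟩
  rw [dist_eq_r, r]
  have hsupp : Function.support (fun n : ℤ => min (1 / (w.a n.natAbs + 1)) (dist (x n) (y n))) ⊆
      {n | n ∉ S} := by
    intro n hn hnS
    refine hn ?_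
    dsimp only
    rw [hxy n (Finset.le_sup (f := Int.natAbs) hnS), dist_self]
    exact min_eq_right (weight_pos w _).le
  rw [← tsum_subtype_eq_of_support_subset hsupp]
  exact Summable.tsum_le_tsum (fun n => min_le_left _ _)
    ((summable_term x y).subtype _) ((summable_weight w).subtype _)

end FullShift

theorem birkhoffSum_mul_eq {X : Type*} (T : X → X) (f : X → ℝ) (n m : ℕ) (x : X) :
    birkhoffSum T f (m * n) x = ∑ q ∈ Finset.range m, birkhoffSum T f n (T^[q * n] x) := by
  induction m with
  | zero => simp
  | succ m ih => rw [Finset.sum_range_succ, ← ih, Nat.succ_mul, birkhoffSum_add]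

namespace FullShift

variable {M : Type*} [MetricSpace M] [CompactSpace M] {w : SubexpSeq}

/-- Away from block ends uniform continuity gives an error `ε / 2`; the at most `2L` other times
cost `2‖f‖` each, negligible for large `n`. The threshold is independent of `m` and `x`, so `n` may
be fixed before sampling. -/
theorem eventually_birkhoffSum_concat_close (f : C(FullShift M w, ℝ)) {ε : ℝ} (hε : 0 < ε) :
    ∀ᶠ n : ℕ in atTop, ∀ (m : ℕ) (x : ℕ → FullShift M w), ∀ q < m,
      |birkhoffSum shift f n (shift^[q * n] (concat n m x)) - birkhoffSum shift f n (x q)| ≤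
        ε * n := by
  have huc := CompactSpace.uniformContinuous_of_continuous f.continuous
  obtain ⟨δ, hδ, hfδ⟩ := Metric.uniformContinuous_iff.1 huc (ε / 2) (by positivity)
  obtain ⟨L, hL⟩ := exists_dist_lt_of_eqOn (M := M) w hδ
  set C := ‖f‖ with hC
  have hbig : ∀ᶠ n : ℕ in atTop, 2 * C * (2 * L) / (ε / 2) ≤ n :=
    tendsto_natCast_atTop_atTop.eventually_ge_atTop _
  filter_upwards [hbig] with n hn m x q hq
  rw [div_le_iff₀ (by positivity)] at hn
  have hterm : ∀ s ∈ Finset.range n,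
      |f (shift^[s] (shift^[q * n] (concat n m x))) - f (shift^[s] (x q))| ≤
        ε / 2 + if s < L ∨ n ≤ s + L then 2 * C else 0 := by
    intro s _
    split_ifs with h
    · have h1 := f.norm_coe_le_norm (shift^[s] (shift^[q * n] (concat n m x)))
      have h2 := f.norm_coe_le_norm (shift^[s] (x q))
      have h3 := norm_sub_le (f (shift^[s] (shift^[q * n] (concat n m x)))) (f (shift^[s] (x q)))
      rw [Real.norm_eq_abs] at h3
      linarith
    · push Not at h
      rw [add_zero]
      exact (hfδ (hL _ _ fun i hi => iterate_shift_concat_apply x hq h.1 h.2 hi)).le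
  have hcard : ((Finset.range n).filter fun s => s < L ∨ n ≤ s + L).card ≤ 2 * L := by
    have hsub : ((Finset.range n).filter fun s => s < L ∨ n ≤ s + L) ⊆
        Finset.range L ∪ Finset.Ico (n - L) n := by
      intro s hs
      simp only [Finset.mem_filter, Finset.mem_range, Finset.mem_union, Finset.mem_Ico] at hs ⊢
      omega
    refine (Finset.card_le_card hsub).trans ((Finset.card_union_le _ _).trans ?_)
    rw [Finset.card_range, Nat.card_Ico]
    omega
  calc |birkhoffSum shift f n (shift^[q * n] (concat n m x)) - birkhoffSum shift f n (x q)|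
      = |∑ s ∈ Finset.range n, (f (shift^[s] (shift^[q * n] (concat n m x))) -
          f (shift^[s] (x q)))| := by rw [Finset.sum_sub_distrib]; rfl
    _ ≤ ∑ s ∈ Finset.range n, (ε / 2 + if s < L ∨ n ≤ s + L then 2 * C else 0) :=
      (Finset.abs_sum_le_sum_abs _ _).trans (Finset.sum_le_sum hterm)
    _ = n * (ε / 2) + ((Finset.range n).filter fun s => s < L ∨ n ≤ s + L).card * (2 * C) := by
      rw [Finset.sum_add_distrib, ← Finset.sum_filter]
      simp
    _ ≤ n * (ε / 2) + (2 * L : ℕ) * (2 * C) := by gcongr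
    _ ≤ ε * n := by push_cast; linarith

theorem eventually_birkhoffAverage_concat_close (f : C(FullShift M w, ℝ)) {ε : ℝ} (hε : 0 < ε) :
    ∀ᶠ n : ℕ in atTop, ∀ (m : ℕ) (x : ℕ → FullShift M w), 0 < m →
      |birkhoffAverage ℝ shift f (m * n) (concat n m x) -
        (∑ q ∈ Finset.range m, birkhoffAverage ℝ shift f n (x q)) / m| ≤ ε := by
  filter_upwards [eventually_birkhoffSum_concat_close f hε, eventually_gt_atTop 0]
    with n hn hn0 m x hm
  have hm' : (0 : ℝ) < m := by exact_mod_cast hm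
  have hn' : (0 : ℝ) < n := by exact_mod_cast hn0
  have h1 : birkhoffAverage ℝ shift f (m * n) (concat n m x) -
      (∑ q ∈ Finset.range m, birkhoffAverage ℝ shift f n (x q)) / m =
      ((m : ℝ) * n)⁻¹ * ∑ q ∈ Finset.range m,
        (birkhoffSum shift f n (shift^[q * n] (concat n m x)) - birkhoffSum shift f n (x q)) := by
    simp only [birkhoffAverage, smul_eq_mul, birkhoffSum_mul_eq, Finset.sum_sub_distrib,
      ← Finset.mul_sum]
    push_cast
    field_simp
  rw [h1, abs_mul, abs_of_pos (by positivity), inv_mul_le_iff₀ (by positivity)]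
  refine (Finset.abs_sum_le_sum_abs _ _).trans ?_
  refine (Finset.sum_le_sum fun q hq => hn m x q (Finset.mem_range.1 hq)).trans ?_
  simp only [Finset.sum_const, Finset.card_range, nsmul_eq_mul]
  linarith

/-- The invariant measure carried by a periodic orbit. -/
noncomputable def periodicMeasure (x : FullShift M w) {p : ℕ} (hp : 0 < p)
    (hx : shift^[p] x = x) : InvariantMeasure M w :=
  ⟨⟨orbitMeasure shift x p, isProbabilityMeasure_orbitMeasure _ _ hp⟩,
    measurePreserving_orbitMeasure continuous_shift.measurable hx⟩

theorem dense_of_periodicMeasure_mem {S : Set (InvariantMeasure M w)}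
    (hS : ∀ (x : FullShift M w) (p : ℕ) (hp : 0 < p) (hx : shift^[p] x = x),
      periodicMeasure x hp hx ∈ S) : Dense S := by
  classical
  intro μ
  refine mem_closure_of_forall_finset_integral fun F ε hε => ?_
  have hev : ∀ᶠ n : ℕ in atTop, ∀ f ∈ F, ∀ (m : ℕ) (x : ℕ → FullShift M w), 0 < m →
      |birkhoffAverage ℝ shift f (m * n) (concat n m x) -
        (∑ q ∈ Finset.range m, birkhoffAverage ℝ shift f n (x q)) / m| ≤ ε / 2 :=
    (eventually_all_finset F).2 fun f _ =>
      eventually_birkhoffAverage_concat_close f.toContinuousMap (half_pos hε)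
  obtain ⟨n, hn, hn0⟩ := (hev.and (eventually_gt_atTop 0)).exists
  have hcont : ∀ f ∈ F, Continuous (birkhoffAverage ℝ shift f n) := fun f _ =>
    continuous_birkhoffAverage continuous_shift f.continuous n
  -- The sampled functions are the length-`n` averages, which by invariance have the same integrals
  -- as the functions `f`.
  obtain ⟨m, x, hm, hmx⟩ := exists_sample_averages_close (μ.1 : Measure (FullShift M w))
    (F.image fun f : BoundedContinuousFunction (FullShift M w) ℝ => birkhoffAverage ℝ shift f n)
    (by
      intro g hg
      obtain ⟨f, hf, rfl⟩ := Finset.mem_image.1 hg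
      exact (hcont f hf).measurable)
    (by
      intro g hg
      obtain ⟨f, hf, rfl⟩ := Finset.mem_image.1 hg
      exact (hcont f hf).integrable_of_compactSpace _) (half_pos hε)
  refine ⟨_, hS (concat n m x) (m * n) (Nat.mul_pos hm hn0) (iterate_shift_concat hn0 m x),
    fun f hf => ?_⟩
  have h1 := hn f hf m x hm
  have h2 := hmx _ (Finset.mem_image_of_mem _ hf)
  rw [integral_birkhoffAverage μ.2 (f.integrable _) hn0] at h2
  have h3 : ∫ y, f y ∂(orbitMeasure shift (concat n m x) (m * n)) =
      birkhoffAverage ℝ shift f (m * n) (concat n m x) :=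
    integral_orbitMeasure f.continuous.measurable.stronglyMeasurable _ _
  change |∫ y, f y ∂(orbitMeasure shift (concat n m x) (m * n)) - _| < ε
  rw [h3]
  refine (abs_sub_le _ _ _).trans_lt ((add_lt_add_of_le_of_lt h1 h2).trans_le ?_)
  linarith

end FullShift

/-! ### Random perturbations -/

/-- The fair coin. -/
noncomputable def fairCoin : Measure Bool :=
  (2⁻¹ : ℝ≥0∞) • (Measure.dirac true + Measure.dirac false)

instance : IsProbabilityMeasure fairCoin := by
  refine ⟨?_⟩
  simp only [fairCoin, Measure.smul_apply, Measure.add_apply, measure_univ, smul_eq_mul]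
  rw [one_add_one_eq_two]
  exact ENNReal.inv_mul_cancel (by simp) (by simp)

theorem fairCoin_le_half {s : Set Bool} (hs : ¬(true ∈ s ∧ false ∈ s)) : fairCoin s ≤ 1 / 2 := by
  have hm : MeasurableSet s := trivial
  simp only [fairCoin, Measure.smul_apply, Measure.add_apply, smul_eq_mul,
    Measure.dirac_apply' _ hm, indicator, Pi.one_apply]
  by_cases h1 : true ∈ s <;> by_cases h2 : false ∈ s
  · exact absurd ⟨h1, h2⟩ hs
  all_goals simp [h1, h2]

/-- Independent fair coin tosses indexed by `ℤ`. -/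
noncomputable def coinTosses : Measure (ℤ → Bool) := Measure.infinitePi fun _ => fairCoin

instance : IsProbabilityMeasure coinTosses :=
  inferInstanceAs (IsProbabilityMeasure (Measure.infinitePi fun _ => fairCoin))

/-- Reindexing a product of identical factors preserves it. -/
theorem measurePreserving_coinTosses :
    MeasurePreserving (fun (ω : ℤ → Bool) (i : ℤ) => ω (i - 1)) coinTosses coinTosses := by
  refine ⟨by fun_prop, ?_⟩
  have h := Measure.infinitePi_map_piCongrLeft (X := fun _ : ℤ => Bool) (fun _ => fairCoin)
    (Equiv.addRight (1 : ℤ))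
  have h2 : (MeasurableEquiv.piCongrLeft (fun _ : ℤ => Bool) (Equiv.addRight (1 : ℤ)) :
      (ℤ → Bool) → (ℤ → Bool)) = fun ω i => ω (i - 1) := by
    funext ω i
    have := Equiv.piCongrLeft_apply_apply (fun _ : ℤ => Bool) (Equiv.addRight (1 : ℤ)) ω (i - 1)
    rw [MeasurableEquiv.coe_piCongrLeft]
    simpa using this
  rw [h2] at h
  exact h

/-- `f` projects to a nearest point of a finite net, and `g` moves that point to a different one
nearby, which exists by perfectness. The range of `f` is finite, so the separation has a positive
minimum. -/
theorem exists_measurable_perturbations {M : Type*} [MetricSpace M] [CompactSpace M]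
    [PerfectSpace M] [Nonempty M] [MeasurableSpace M] [BorelSpace M] {δ : ℝ} (hδ : 0 < δ) :
    ∃ f g : M → M, Measurable f ∧ Measurable g ∧ (∀ x, dist (f x) x < δ) ∧
      (∀ x, dist (g x) x < δ) ∧ ∃ η > 0, ∀ x, η ≤ dist (f x) (g x) := by
  let e := TopologicalSpace.denseSeq M
  obtain ⟨t, ht⟩ := isCompact_univ.elim_finite_subcover (fun n => Metric.ball (e n) (δ / 2))
    (fun n => Metric.isOpen_ball) (fun x _ => by
      obtain ⟨n, hy⟩ :=
        (TopologicalSpace.denseRange_denseSeq M).exists_dist_lt x (half_pos hδ)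
      exact mem_iUnion.2 ⟨n, hy⟩)
  have hq : ∀ p : M, ∃ y, y ≠ p ∧ dist y p < δ / 2 := by
    intro p
    have h1 : ∀ᶠ y in 𝓝[≠] p, dist y p < δ / 2 :=
      mem_nhdsWithin_of_mem_nhds (Metric.ball_mem_nhds p (half_pos hδ))
    obtain ⟨y, hy, hyp⟩ := (h1.and self_mem_nhdsWithin).exists
    exact ⟨y, hyp, hy⟩
  choose q hqne hq using hq
  let f := SimpleFunc.nearestPt e (t.sup id)
  have hf : ∀ x, dist (f x) x < δ / 2 := by
    intro x
    obtain ⟨n, hn, hx⟩ := mem_iUnion₂.1 (ht (mem_univ x))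
    have h1 := SimpleFunc.edist_nearestPt_le e x (Finset.le_sup (f := id) hn)
    rw [edist_dist, edist_dist, ENNReal.ofReal_le_ofReal_iff dist_nonneg] at h1
    rw [Metric.mem_ball, dist_comm] at hx
    exact h1.trans_lt hx
  obtain ⟨p, -, hp⟩ := f.range.exists_min_image (fun p => dist p (q p))
    (Finset.Nonempty.mono (fun _ h => h) ⟨f (Classical.arbitrary M), f.mem_range_self _⟩)
  refine ⟨f, f.map q, f.measurable, (f.map q).measurable, fun x => (hf x).trans (by linarith),
    fun x => ?_, dist p (q p), dist_pos.2 (hqne p).symm, fun x => ?_⟩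
  · have h1 := dist_triangle (q (f x)) (f x) x
    have h2 := hq (f x)
    have h3 := hf x
    rw [SimpleFunc.map_apply]
    linarith
  · exact hp _ (f.mem_range_self x)

/-- Take `2ρ = exp (-βL)` with `β = log 2 / (k + 1)`: then `(2ρ) ^ k = 2 ^ (-Lk / (k + 1))` exceeds
`2 ^ (-L)`, while `6ρ (a_L + 1)` tends to 0 by subexponential growth. -/
theorem SubexpSeq.exists_scale (w : SubexpSeq) (k : ℕ) {η : ℝ} (hη : 0 < η) :
    ∃ (ρ : ℝ) (L : ℕ), 0 < ρ ∧ 2 * ρ ≤ 1 / ((k : ℝ) + 1) ∧ 6 * ρ < 1 / (w.a L + 1) ∧ 6 * ρ < η ∧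
      (1 / 2 : ℝ≥0∞) ^ L < ENNReal.ofReal (2 * ρ) ^ (k : ℝ) := by
  set β := Real.log 2 / ((k : ℝ) + 1) with hβ
  have hlog : 0 < Real.log 2 := Real.log_pos (by norm_num)
  have hβ0 : 0 < β := by positivity
  have hβk : β * k < Real.log 2 := by
    rw [hβ, div_mul_eq_mul_div, div_lt_iff₀ (by positivity)]
    nlinarith
  have hexp : Tendsto (fun L : ℕ => Real.exp (-(β * L))) atTop (𝓝 0) :=
    Real.tendsto_exp_neg_atTop_nhds_zero.comp
      (tendsto_natCast_atTop_atTop.const_mul_atTop hβ0)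
  have hmul : Tendsto (fun L : ℕ => 3 * (w.a L / Real.exp (β * L) + Real.exp (-(β * L)))) atTop
      (𝓝 0) := by
    simpa using ((w.subexp β hβ0).add hexp).const_mul 3
  have hexp3 : Tendsto (fun L : ℕ => 3 * Real.exp (-(β * L))) atTop (𝓝 0) := by
    simpa using hexp.const_mul 3
  obtain ⟨L, h1, h2, h3, h4⟩ := ((hexp.eventually_le_const
    (show (0 : ℝ) < 1 / ((k : ℝ) + 1) by positivity)).and
    ((hmul.eventually_lt_const one_pos).and ((hexp3.eventually_lt_const hη).and
      (eventually_gt_atTop 0)))).exists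
  have ha : 0 < w.a L + 1 := by linarith [w.neg_one_lt L]
  refine ⟨Real.exp (-(β * L)) / 2, L, by positivity, by linarith, ?_, by linarith, ?_⟩
  · rw [lt_div_iff₀ ha]
    rw [div_eq_mul_inv, ← Real.exp_neg] at h2
    linarith
  · have h5 : (1 / 2 : ℝ≥0∞) ^ L = ENNReal.ofReal (Real.exp (-(Real.log 2 * L))) := by
      have : Real.exp (-(Real.log 2 * L)) = (1 / 2 : ℝ) ^ L := by
        rw [← neg_mul, mul_comm, Real.exp_nat_mul, Real.exp_neg, Real.exp_log (by norm_num)]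
        norm_num
      rw [this, ENNReal.ofReal_pow (by norm_num), ENNReal.ofReal_div_of_pos (by norm_num)]
      simp
    have hL : (0 : ℝ) < L := by exact_mod_cast h4
    rw [h5, mul_div_cancel₀ _ (two_ne_zero), ENNReal.ofReal_rpow_of_pos (Real.exp_pos _),
      ← Real.exp_mul, ENNReal.ofReal_lt_ofReal_iff (Real.exp_pos _), Real.exp_lt_exp]
    nlinarith

namespace FullShift

variable {M : Type*} [MetricSpace M] [CompactSpace M] {w : SubexpSeq}

section Randomize

variable [MeasurableSpace M] [BorelSpace M]

theorem measurable_iff {α : Type*} [MeasurableSpace α] {f : α → FullShift M w} :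
    Measurable f ↔ ∀ i : ℤ, Measurable fun a => f a i := by
  have h : borel (ℤ → M) = MeasurableSpace.pi := (BorelSpace.measurable_eq (α := ℤ → M)).symm
  change @Measurable α (ℤ → M) _ (borel (ℤ → M)) f ↔ _
  rw [h]
  exact measurable_pi_iff

/-- Replace each coordinate `x i` by `f (x i)` or `g (x i)`, according to the `i`-th toss. -/
def randomize (f g : M → M) (z : FullShift M w × (ℤ → Bool)) : FullShift M w :=
  fun i => bif z.2 i then f (z.1 i) else g (z.1 i)

theorem measurable_randomize {f g : M → M} (hf : Measurable f) (hg : Measurable g) :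
    Measurable (randomize f g : FullShift M w × (ℤ → Bool) → FullShift M w) := by
  refine measurable_iff.2 fun i => ?_
  have h1 : Measurable fun z : FullShift M w × (ℤ → Bool) => z.1 i :=
    measurable_iff.1 measurable_fst i
  have h2 : Measurable fun z : FullShift M w × (ℤ → Bool) => z.2 i := by fun_prop
  simp only [randomize, Bool.cond_eq_ite]
  exact Measurable.ite (h2 (measurableSet_singleton true)) (hf.comp h1) (hg.comp h1)

/-- The image of an invariant measure under independent random perturbations. -/
noncomputable def randomized (μ : InvariantMeasure M w) {f g : M → M} (hf : Measurable f)
    (hg : Measurable g) : InvariantMeasure M w :=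
  ⟨⟨((μ.1 : Measure (FullShift M w)).prod coinTosses).map (randomize f g),
    Measure.isProbabilityMeasure_map (measurable_randomize hf hg).aemeasurable⟩, by
    have hT : Measurable (shift : FullShift M w → FullShift M w) := continuous_shift.measurable
    refine ⟨hT, ?_⟩
    have hmp := μ.2.prod measurePreserving_coinTosses
    have hcomm : (shift ∘ randomize f g : FullShift M w × (ℤ → Bool) → FullShift M w) =
        randomize f g ∘ Prod.map shift (fun (ω : ℤ → Bool) (i : ℤ) => ω (i - 1)) := rfl
    change Measure.map shift (Measure.map (randomize f g) _) = Measure.map (randomize f g) _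
    rw [Measure.map_map hT (measurable_randomize hf hg), hcomm,
      ← Measure.map_map (measurable_randomize hf hg) hmp.measurable, hmp.map_eq]⟩

/-- Since `R` is below the weights of the coordinates `1, …, L`, a point of the ball is within `R`
of `z` in each of them. As `f` and `g` differ by more than `2R`, this allows at most one outcome of
each toss, whatever `x` is. -/
theorem randomized_closedBall_le (μ : InvariantMeasure M w) {f g : M → M} (hf : Measurable f)
    (hg : Measurable g) {R : ℝ} (hfg : ∀ x, 2 * R < dist (f x) (g x)) {L : ℕ}
    (hL : R < 1 / (w.a L + 1)) (z : FullShift M w) :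
    ((randomized μ hf hg).1 : Measure (FullShift M w)) (Metric.closedBall z R) ≤ (1 / 2) ^ L := by
  have hm := measurable_randomize (w := w) hf hg
  have hB : MeasurableSet (Metric.closedBall z R) := Metric.isClosed_closedBall.measurableSet
  have hx : ∀ x : FullShift M w,
      coinTosses (Prod.mk x ⁻¹' (randomize f g ⁻¹' Metric.closedBall z R)) ≤ (1 / 2) ^ L := by
    intro x
    let S : ℤ → Set Bool := fun n => {b | dist (bif b then f (x n) else g (x n)) (z n) ≤ R}
    have hsub : Prod.mk x ⁻¹' (randomize f g ⁻¹' Metric.closedBall z R) ⊆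
        (Finset.Icc (1 : ℤ) L : Set ℤ).pi S := by
      intro ω hω n hn
      have hn' : n.natAbs ≤ L := by
        have := Finset.mem_Icc.1 (Finset.mem_coe.1 hn)
        omega
      have h1 : min (1 / (w.a n.natAbs + 1)) (dist (randomize f g (x, ω) n) (z n)) ≤ R :=
        (term_le_r _ _ n).trans hω
      have h2 : 1 / (w.a L + 1) ≤ 1 / (w.a n.natAbs + 1) :=
        one_div_le_one_div_of_le (by linarith [w.neg_one_lt n.natAbs])
          (by linarith [w.monotone hn'])
      rcases min_le_iff.1 h1 with h3 | h3
      · linarith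
      · exact h3
    refine (measure_mono hsub).trans ?_
    rw [coinTosses, Measure.infinitePi_pi _ (fun n _ => MeasurableSet.of_discrete (s := S n))]
    refine (Finset.prod_le_pow_card _ _ (1 / 2) fun n _ => fairCoin_le_half ?_).trans_eq ?_
    · rintro ⟨h1, h2⟩
      have h1' : dist (f (x n)) (z n) ≤ R := h1
      have h2' : dist (g (x n)) (z n) ≤ R := h2
      have h3 := dist_triangle_right (f (x n)) (g (x n)) (z n)
      linarith [hfg (x n)]
    · simp
  change Measure.map (randomize f g) _ _ ≤ _
  rw [Measure.map_apply hm hB, Measure.prod_apply (hm hB)]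
  refine (lintegral_mono hx).trans ?_
  simp

/-- Dominated convergence: the perturbed sequences converge coordinatewise. -/
theorem tendsto_randomized (μ : InvariantMeasure M w) {f g : ℕ → M → M}
    (hf : ∀ n, Measurable (f n)) (hg : ∀ n, Measurable (g n))
    (hfx : ∀ x, Tendsto (fun n => f n x) atTop (𝓝 x))
    (hgx : ∀ x, Tendsto (fun n => g n x) atTop (𝓝 x)) :
    Tendsto (fun n => randomized μ (hf n) (hg n)) atTop (𝓝 μ) := by
  refine tendsto_subtype_rng.2 (ProbabilityMeasure.tendsto_iff_forall_integral_tendsto.2 fun h => ?_)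
  have h1 : ∀ n, ∫ x, h x ∂((randomized μ (hf n) (hg n)).1 : Measure (FullShift M w)) =
      ∫ z, h (randomize (f n) (g n) z) ∂((μ.1 : Measure (FullShift M w)).prod coinTosses) :=
    fun n => integral_map (measurable_randomize (hf n) (hg n)).aemeasurable
      h.continuous.measurable.aestronglyMeasurable
  have h2 : ∫ x, h x ∂(μ.1 : Measure (FullShift M w)) =
      ∫ z, h z.1 ∂((μ.1 : Measure (FullShift M w)).prod coinTosses) := by
    have hmp := measurePreserving_fst (μ := (μ.1 : Measure (FullShift M w))) (ν := coinTosses)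
    rw [← hmp.map_eq, integral_map hmp.measurable.aemeasurable
      h.continuous.measurable.aestronglyMeasurable, hmp.map_eq]
  simp only [h1]
  rw [h2]
  refine tendsto_integral_of_dominated_convergence (fun _ => ‖h‖) (fun n => ?_)
    (integrable_const _) (fun n => ae_of_all _ fun z => h.norm_coe_le_norm _)
    (ae_of_all _ fun z => ?_)
  · exact (h.continuous.measurable.comp (measurable_randomize (hf n) (hg n))).aestronglyMeasurable
  · refine (h.continuous.tendsto z.1).comp (tendsto_pi_nhds.2 fun i => ?_)
    cases hz : z.2 i
    · simpa [randomize, hz] using hgx (z.1 i)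
    · simpa [randomize, hz] using hfx (z.1 i)

end Randomize

/-! ### Residual properties of invariant measures -/

/-- The measures obeying a finite system of ball bounds of order `k` at some scale below
`1 / (k + 1)`. -/
def smallBallSet (M : Type*) [MetricSpace M] (w : SubexpSeq) (k : ℕ) :
    Set (InvariantMeasure M w) :=
  {μ | ∃ (ρ : ℝ) (F : Finset (FullShift M w)), (0 < ρ ∧ 2 * ρ ≤ 1 / ((k : ℝ) + 1) ∧
    ∀ z, ∃ y ∈ F, dist z y ≤ ρ) ∧ ∀ y ∈ F, (μ.1 : Measure (FullShift M w))
      (Metric.closedBall y (6 * ρ)) < ENNReal.ofReal (2 * ρ) ^ (k : ℝ)}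

theorem isOpen_smallBallSet {M : Type*} [MetricSpace M] {w : SubexpSeq} (k : ℕ) :
    IsOpen (smallBallSet M w k) := by
  refine isOpen_iff_mem_nhds.2 ?_
  rintro μ ⟨ρ, F, h, hμ⟩
  have hev : ∀ᶠ ν : InvariantMeasure M w in 𝓝 μ, ∀ y ∈ F, (ν.1 : Measure (FullShift M w))
      (Metric.closedBall y (6 * ρ)) < ENNReal.ofReal (2 * ρ) ^ (k : ℝ) :=
    (eventually_all_finset F).2 fun y hy =>
      ((isOpen_setOf_measure_closed_lt Metric.isClosed_closedBall _).preimage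
        continuous_subtype_val).mem_nhds (hμ y hy)
  filter_upwards [hev] with ν hν
  exact ⟨ρ, F, h, hν⟩

theorem dense_smallBallSet [PerfectSpace M] (k : ℕ) : Dense (smallBallSet M w k) := by
  intro μ
  let _ : MeasurableSpace M := borel M
  have _ : BorelSpace M := ⟨rfl⟩
  have hne : Nonempty M := by
    obtain ⟨x⟩ := nonempty_of_isProbabilityMeasure (μ.1 : Measure (FullShift M w))
    exact ⟨x 0⟩
  choose f g hf hg hfx hgx η hη hfg using fun n : ℕ =>
    exists_measurable_perturbations (M := M) (δ := 1 / ((n : ℝ) + 1)) (by positivity)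
  have hlim : ∀ {u : ℕ → M → M}, (∀ n x, dist (u n x) x < 1 / ((n : ℝ) + 1)) → ∀ x,
      Tendsto (fun n => u n x) atTop (𝓝 x) := fun hu x =>
    tendsto_iff_dist_tendsto_zero.2 (squeeze_zero (fun _ => dist_nonneg) (fun n => (hu n x).le)
      tendsto_one_div_add_atTop_nhds_zero_nat)
  refine mem_closure_of_tendsto (tendsto_randomized μ hf hg (hlim hfx) (hlim hgx))
    (Eventually.of_forall fun n => ?_)
  -- The separation is fixed first and the scale chosen after it; halving it gives `2 * (6ρ) < η n`,
  -- as the ball bound requires.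
  obtain ⟨ρ, L, hρ, hρk, hρL, hρη, hbound⟩ := w.exists_scale k (half_pos (hη n))
  obtain ⟨t, -, htf, ht⟩ := finite_cover_balls_of_compact
    (isCompact_univ (X := FullShift M w)) hρ
  refine ⟨ρ, htf.toFinset, ⟨hρ, hρk, fun z => ?_⟩, fun y _ => ?_⟩
  · obtain ⟨y, hy, hzy⟩ := mem_iUnion₂.1 (ht (mem_univ z))
    exact ⟨y, htf.mem_toFinset.2 hy, (Metric.mem_ball.1 hzy).le⟩
  · refine (randomized_closedBall_le μ (hf n) (hg n) (fun x => ?_) hρL y).trans_lt hbound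
    linarith [hfg n x]

/-- Any ball of radius `5ρ` lies in one of radius `6ρ` about a point of the finite `ρ`-net; bounding
only the latter keeps the condition open. -/
theorem hasSmallBalls_of_mem {M : Type*} [MetricSpace M] {w : SubexpSeq} {μ : InvariantMeasure M w}
    (h : ∀ k, μ ∈ smallBallSet M w k) :
    HasSmallBalls (μ.1 : Measure (FullShift M w)) := by
  intro k
  obtain ⟨ρ, F, ⟨hρ, hρk, hF⟩, hμ⟩ := h k
  refine ⟨ρ, hρ, hρk, fun z => ?_⟩
  obtain ⟨y, hy, hzy⟩ := hF z
  exact (measure_mono (Metric.closedBall_subset_closedBall' (by linarith))).trans (hμ y hy).le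

/-- The measures almost carried by a finite union of small balls. -/
def smallCoverSet (M : Type*) [MetricSpace M] (w : SubexpSeq) (m : ℕ) :
    Set (InvariantMeasure M w) :=
  {μ | ∃ (F : Finset (FullShift M w)) (ρ : ℝ), (0 < ρ ∧ 2 * ρ ≤ 1 / ((m : ℝ) + 1) ∧
    (F.card : ℝ≥0∞) * ENNReal.ofReal (2 * ρ) ^ (1 / ((m : ℝ) + 1)) ≤ (1 / 2) ^ m) ∧
    (μ.1 : Measure (FullShift M w)) (⋃ x ∈ F, Metric.ball x ρ)ᶜ < (1 / 2) ^ m}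

theorem isOpen_smallCoverSet {M : Type*} [MetricSpace M] {w : SubexpSeq} (m : ℕ) :
    IsOpen (smallCoverSet M w m) := by
  refine isOpen_iff_mem_nhds.2 ?_
  rintro μ ⟨F, ρ, h, hμ⟩
  have hU : IsOpen (⋃ x ∈ F, Metric.ball x ρ) := isOpen_biUnion fun _ _ => Metric.isOpen_ball
  filter_upwards [((isOpen_setOf_measure_closed_lt hU.isClosed_compl _).preimage
    continuous_subtype_val).mem_nhds hμ] with ν hν
  exact ⟨F, ρ, h, hν⟩

/-- A periodic orbit is finite, so the number of balls stays bounded while `ρ → 0`. -/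
theorem dense_smallCoverSet (m : ℕ) : Dense (smallCoverSet M w m) := by
  classical
  refine dense_of_periodicMeasure_mem fun x p hp hx => ?_
  let F := (Finset.range p).image fun k => shift^[k] x
  have ht : Tendsto (fun ρ : ℝ => (F.card : ℝ≥0∞) *
      ENNReal.ofReal (2 * ρ) ^ (1 / ((m : ℝ) + 1))) (𝓝[>] 0) (𝓝 0) := by
    have h1 : Tendsto (fun ρ : ℝ => ENNReal.ofReal (2 * ρ)) (𝓝[>] 0) (𝓝 0) := by
      have : Tendsto (fun ρ : ℝ => ENNReal.ofReal (2 * ρ)) (𝓝 0) (𝓝 (ENNReal.ofReal (2 * 0))) :=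
        (ENNReal.continuous_ofReal.comp (continuous_const.mul continuous_id)).tendsto 0
      simpa using this.mono_left nhdsWithin_le_nhds
    have h2 := (ENNReal.continuous_rpow_const (y := 1 / ((m : ℝ) + 1))).tendsto 0 |>.comp h1
    rw [ENNReal.zero_rpow_of_pos (by positivity)] at h2
    simpa using ENNReal.Tendsto.const_mul h2 (Or.inr (ENNReal.natCast_ne_top F.card))
  have ht2 : ∀ᶠ ρ : ℝ in 𝓝[>] 0, 2 * ρ ≤ 1 / ((m : ℝ) + 1) := by
    have : Tendsto (fun ρ : ℝ => 2 * ρ) (𝓝[>] 0) (𝓝 (2 * 0)) :=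
      ((continuous_const.mul continuous_id).tendsto 0).mono_left nhdsWithin_le_nhds
    rw [mul_zero] at this
    exact this.eventually_le_const (by positivity)
  have hpow : (0 : ℝ≥0∞) < (1 / 2) ^ m := by
    refine pos_iff_ne_zero.2 (pow_ne_zero _ ?_)
    simp
  obtain ⟨ρ, h1, h2, h3⟩ := ((ht.eventually_le_const hpow).and
    (ht2.and self_mem_nhdsWithin)).exists
  refine ⟨F, ρ, ⟨h3, h2, h1⟩, ?_⟩
  have hnull : orbitMeasure shift x p (⋃ x ∈ F, Metric.ball x ρ)ᶜ = 0 := by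
    refine orbitMeasure_compl_eq_zero (isOpen_biUnion fun _ _ => Metric.isOpen_ball).measurableSet
      fun k hk => mem_biUnion (x := shift^[k] x) ?_ (Metric.mem_ball_self h3)
    exact Finset.mem_image_of_mem _ (Finset.mem_range.2 hk)
  change orbitMeasure shift x p _ < _
  rw [hnull]
  exact hpow

/-- The measures for which some Birkhoff average of `f` has variance less than `ε`. -/
def smallVarianceSet (f : C(FullShift M w, ℝ)) (ε : ℝ) : Set (InvariantMeasure M w) :=
  {μ | ∃ N : ℕ, 0 < N ∧
    ∫ x, birkhoffAverage ℝ shift f N x ^ 2 ∂(μ.1 : Measure (FullShift M w)) -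
      (∫ x, f x ∂(μ.1 : Measure (FullShift M w))) ^ 2 < ε}

theorem continuous_integral {h : FullShift M w → ℝ} (hh : Continuous h) :
    Continuous fun μ : InvariantMeasure M w => ∫ x, h x ∂(μ.1 : Measure (FullShift M w)) := by
  refine continuous_iff_continuousAt.2 fun μ => ?_
  exact ProbabilityMeasure.tendsto_iff_forall_integral_tendsto.1
    (continuous_subtype_val.tendsto μ) (BoundedContinuousFunction.mkOfCompact ⟨h, hh⟩)

theorem isOpen_smallVarianceSet (f : C(FullShift M w, ℝ)) (ε : ℝ) :
    IsOpen (smallVarianceSet f ε) := by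
  simp only [smallVarianceSet, Set.ofPred_exists, Set.ofPred_and]
  refine isOpen_iUnion fun N => isOpen_const.inter (isOpen_lt ?_ continuous_const)
  exact (continuous_integral ((continuous_birkhoffAverage continuous_shift f.continuous N).pow 2)).sub
    ((continuous_integral f.continuous).pow 2)

theorem dense_smallVarianceSet (f : C(FullShift M w, ℝ)) {ε : ℝ} (hε : 0 < ε) :
    Dense (smallVarianceSet f ε) := by
  refine dense_of_periodicMeasure_mem fun x p hp hx => ⟨p, hp, ?_⟩
  exact (orbitMeasure_variance_eq_zero continuous_shift.measurable hp hx
    f.continuous.measurable).trans_lt hε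

theorem eventually_residual_ergodic :
    ∀ᶠ μ : InvariantMeasure M w in residual (InvariantMeasure M w),
      Ergodic shift (μ.1 : Measure (FullShift M w)) := by
  -- Separability of `C(X, ℝ)` keeps the number of variance conditions countable.
  obtain ⟨D, hDc, hD⟩ := TopologicalSpace.exists_countable_dense C(FullShift M w, ℝ)
  have h : ∀ᶠ μ : InvariantMeasure M w in residual (InvariantMeasure M w),
      ∀ f ∈ D, ∀ n : ℕ, μ ∈ smallVarianceSet f (1 / ((n : ℝ) + 1)) :=
    (eventually_countable_ball hDc).2 fun f _ => eventually_countable_forall.2 fun n =>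
      residual_of_dense_open (isOpen_smallVarianceSet f _)
        (dense_smallVarianceSet f (by positivity))
  filter_upwards [h] with μ hμ
  refine ergodic_of_birkhoffAverage_variance continuous_shift μ.2 hD fun f hf ε hε => ?_
  obtain ⟨n, hn⟩ := exists_nat_one_div_lt hε
  obtain ⟨N, hN, hvar⟩ := hμ f hf n
  exact ⟨N, hN, hvar.trans hn⟩

theorem eventually_residual_upperHausdorffDim :
    ∀ᶠ μ : InvariantMeasure M w in residual (InvariantMeasure M w),
      upperHausdorffDim (μ.1 : Measure (FullShift M w)) = 0 := by
  have h : ∀ᶠ μ : InvariantMeasure M w in residual (InvariantMeasure M w),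
      ∀ m : ℕ, μ ∈ smallCoverSet M w m := eventually_countable_forall.2 fun m =>
    residual_of_dense_open (isOpen_smallCoverSet m) (dense_smallCoverSet m)
  filter_upwards [h] with μ hμ
  refine upperHausdorffDim_eq_zero_of_covers _ fun m => ?_
  obtain ⟨F, ρ, ⟨h1, h2, h3⟩, h4⟩ := hμ m
  exact ⟨F, ρ, h1, h2, h3, h4⟩

theorem eventually_residual_lowerPackingDim [PerfectSpace M] :
    ∀ᶠ μ : InvariantMeasure M w in residual (InvariantMeasure M w),
      lowerPackingDim (μ.1 : Measure (FullShift M w)) = ⊤ := by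
  have h : ∀ᶠ μ : InvariantMeasure M w in residual (InvariantMeasure M w),
      ∀ k : ℕ, μ ∈ smallBallSet M w k := eventually_countable_forall.2 fun k =>
    residual_of_dense_open (isOpen_smallBallSet k) (dense_smallBallSet k)
  filter_upwards [h] with μ hμ
  exact (hasSmallBalls_of_mem hμ).lowerPackingDim_eq_top

end FullShift

theorem corollary1p3 {M : Type*} [MetricSpace M] [CompactSpace M] [PerfectSpace M]
    (w : SubexpSeq) :
    {μ : InvariantMeasure M w |
      Ergodic FullShift.shift (μ.1 : Measure (FullShift M w)) ∧
      upperHausdorffDim (μ.1 : Measure (FullShift M w)) = 0 ∧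
      lowerPackingDim (μ.1 : Measure (FullShift M w)) = ⊤} ∈ residual (InvariantMeasure M w) := by
  filter_upwards [FullShift.eventually_residual_ergodic,
    FullShift.eventually_residual_upperHausdorffDim,
    FullShift.eventually_residual_lowerPackingDim] with μ h1 h2 h3
  exact ⟨h1, h2, h3⟩
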